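/- Let $G$ be a discrete group acting by $*$-automorphisms $\alpha$ on a (not necessarily unital) C*-algebra $A$, and let $(\pi,u,H)$ be a covariant representation of the C*-dynamical system $(G,A,\alpha)$: $\pi$ is a $*$-representation of $A$ and $u$ a unitary representation of $G$, both on the complex Hilbert space $H$, with $u_t\pi(a)u_t^*=\pi(\alpha_t(a))$ for all $t\in G$, $a\in A$. Let $A^\alpha=\{a\in A:\alpha_t(a)=a \text{ for all } t\in G\}$ be the fixed point algebra. A $G$-map $B(H)\to B(H)$ is a unital completely positive map that is equivariant for the action $x\mapsto u_t x u_t^*$ of $G$ on $B(H)$. Let $\mathfrak M$ be the set of all $G$-maps $\phi:B(H)\to B(H)$ with $\phi(x)=x$ for all $x\in\pi(A^\alpha)$, preordered by $\phi\le\psi$ if and only if $\|\phi(x)\|\le\|\psi(x)\|$ for all $x\in B(H)$. The boundary $\mathcal B_{\pi,u}\subseteq B(H)$ is the image of a minimal element of $\mathfrak M$, that is, of some $\phi\in\mathfrak M$ such that $\psi\in\mathfrak M$ and $\psi\le\phi$ imply $\phi\le\psi$. The covariant representation $(\pi,u,H)$ is called amenable if there is a $G$-projection of $B(H)$ onto $\pi(A^\alpha)$,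 i.e. an idempotent $G$-map $B(H)\to B(H)$ with image $\pi(A^\alpha)$. **Proposition.** $\mathfrak M$ has a minimal element, and for every choice of the minimal element defining $\mathcal B_{\pi,u}$ one has $\mathcal B_{\pi,u}=\pi(A^\alpha)$ if and only if $(\pi,u,H)$ is amenable. -/

import Mathlib

open scoped CStarAlgebra

/-- A covariant representation `(π, u, H)` of the C*-dynamical system `(G, A, α)` (with `G` a
discrete group) on the Hilbert space `H`: a `*`-representation `π` of `A` (not assumed to be
unital or nondegenerate) and a unitary representation `u` of `G` with
`u_t π(a) u_t* = π(α_t(a))`. -/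
structure CovariantRep {G A : Type*} [Group G] [NonUnitalCStarAlgebra A]
    (α : G →* (A ≃⋆ₐ[ℂ] A)) (H : Type*) [NormedAddCommGroup H] [InnerProductSpace ℂ H]
    [CompleteSpace H] where
  /-- the representation of the C*-algebra -/
  π : A →⋆ₙₐ[ℂ] (H →L[ℂ] H)
  /-- the unitary representation of the group -/
  u : G →* unitary (H →L[ℂ] H)
  covariance : ∀ (t : G) (a : A),
    (u t : H →L[ℂ] H) * π a * star (u t : H →L[ℂ] H) = π (α t a)

/-- The fixed point algebra `A^α = {a ∈ A : α_t(a) = a for all t ∈ G}`. -/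
def fixedPointAlgebra {G A : Type*} [Group G] [NonUnitalCStarAlgebra A]
    (α : G →* (A ≃⋆ₐ[ℂ] A)) : NonUnitalStarSubalgebra ℂ A where
  carrier := {a | ∀ t : G, α t a = a}
  add_mem' ha hb t := by rw [map_add, ha t, hb t]
  zero_mem' t := map_zero _
  mul_mem' ha hb t := by rw [map_mul, ha t, hb t]
  smul_mem' c a ha t := by rw [map_smul, ha t]
  star_mem' ha t := by rw [map_star, ha t]

namespace CovariantRep

variable {G A H : Type*} [Group G] [NonUnitalCStarAlgebra A] {α : G →* (A ≃⋆ₐ[ℂ] A)}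
  [NormedAddCommGroup H] [InnerProductSpace ℂ H] [CompleteSpace H]

/-- The image `π(A^α) ⊆ B(H)` of the fixed point algebra. -/
noncomputable def fixedImage (R : CovariantRep α H) : NonUnitalStarSubalgebra ℂ (H →L[ℂ] H) :=
  (fixedPointAlgebra α).map R.π

/-- A `G`-map `B(H) → B(H)`: a unital completely positive map that is equivariant for the action
`Ad_u` of `G` on `B(H)`. -/
structure IsGMap (R : CovariantRep α H) (φ : (H →L[ℂ] H) →CP (H →L[ℂ] H)) : Prop where
  map_one : φ 1 = 1
  equivariant : ∀ (t : G) (x : H →L[ℂ] H),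
    φ ((R.u t : H →L[ℂ] H) * x * star (R.u t : H →L[ℂ] H)) =
      (R.u t : H →L[ℂ] H) * φ x * star (R.u t : H →L[ℂ] H)

/-- A `G`-projection of `B(H)` onto the subspace `W ⊆ B(H)`: an idempotent `G`-map with
image `W`. -/
structure IsGProjectionOnto (R : CovariantRep α H) (φ : (H →L[ℂ] H) →CP (H →L[ℂ] H))
    (W : Set (H →L[ℂ] H)) : Prop extends R.IsGMap φ where
  idempotent : ∀ x : H →L[ℂ] H, φ (φ x) = φ x
  range_eq : Set.range φ = W

/-- The set `𝔐` of all `G`-maps `B(H) → B(H)` which are the identity on `π(A^α)`. -/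
def gMapsFixing (R : CovariantRep α H) : Set ((H →L[ℂ] H) →CP (H →L[ℂ] H)) :=
  {φ | R.IsGMap φ ∧ ∀ x ∈ R.fixedImage, φ x = x}

/-- `φ` is a minimal element of `𝔐` for the (pre)order
`φ ≤ ψ ↔ ‖φ x‖ ≤ ‖ψ x‖` for all `x ∈ B(H)`. -/
def IsMinimalGMap (R : CovariantRep α H) (φ : (H →L[ℂ] H) →CP (H →L[ℂ] H)) : Prop :=
  φ ∈ R.gMapsFixing ∧
    ∀ ψ ∈ R.gMapsFixing, (∀ x : H →L[ℂ] H, ‖ψ x‖ ≤ ‖φ x‖) → ∀ x : H →L[ℂ] H, ‖φ x‖ ≤ ‖ψ x‖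

/-- `B ⊆ B(H)` is (a realization of) the Furstenberg–Hamana boundary of `(π, u, H)`: the image of
a minimal element of `𝔐`. -/
def IsBoundary (R : CovariantRep α H) (B : Set (H →L[ℂ] H)) : Prop :=
  ∃ φ : (H →L[ℂ] H) →CP (H →L[ℂ] H), R.IsMinimalGMap φ ∧ B = Set.range φ

/-- `(π, u, H)` is amenable: there is a `G`-projection of `B(H)` onto `π(A^α)`. -/
def IsAmenable (R : CovariantRep α H) : Prop :=
  ∃ φ : (H →L[ℂ] H) →CP (H →L[ℂ] H), R.IsGProjectionOnto φ (R.fixedImage : Set (H →L[ℂ] H))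

end CovariantRep

/-! Minimal elements come from Zorn's lemma. Bounded families of operators have weak limits along
ultrafilters, and both membership in `𝔐` and upper bounds on the norm survive such limits, so every
chain has a lower bound (`exists_isMinimalGMap`).

A minimal `φ` is idempotent: the Cesàro means of `φ, φ², …` lie in `𝔐` below `φ`, so by minimality
they dominate it in norm; on `x - φ x` they telescope to `O(1/n)`, whence `φ (x - φ x) = 0`. If `φ`
has image `π(A^α)`, it is therefore the required `G`-projection. Conversely, given a `G`-projection
`E`, the map `E ∘ φ` lies below `φ`, and minimality forces `φ x = E (φ x)`. -/

/-! ### Operator matrices as operators on a Hilbert direct sum -/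

namespace OperatorMatrix

open ContinuousLinearMap Filter
open scoped InnerProductSpace ComplexOrder Topology

section Equiv

variable {H : Type*} [NormedAddCommGroup H] [InnerProductSpace ℂ H]
  {n : Type*}

/-- The coordinate projection of the Hilbert direct sum. -/
noncomputable def coord (i : n) : PiLp 2 (fun _ : n => H) →L[ℂ] H :=
  PiLp.proj 2 (fun _ : n => H) i

@[simp]
lemma coord_apply (i : n) (x : PiLp 2 (fun _ : n => H)) : coord i x = x i := rfl

variable [CompleteSpace H] [Fintype n]

lemma adjoint_coord_apply [DecidableEq n] (i : n) (h : H) :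
    (adjoint (coord i : PiLp 2 (fun _ : n => H) →L[ℂ] H)) h = PiLp.single 2 i h := by
  refine ext_inner_right ℂ fun x => ?_
  rw [adjoint_inner_left, PiLp.inner_apply, Finset.sum_eq_single i]
  · simp
  · intro j _ hj
    rw [PiLp.single_eq_of_ne 2 hj, inner_zero_left]
  · simp

/-- The operator on the Hilbert direct sum given by a matrix of operators. -/
noncomputable def toOperator (M : CStarMatrix n n (H →L[ℂ] H)) :
    PiLp 2 (fun _ : n => H) →L[ℂ] PiLp 2 (fun _ : n => H) :=
  ∑ i, ∑ j, adjoint (coord i) ∘L M i j ∘L coord j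

lemma toOperator_apply (M : CStarMatrix n n (H →L[ℂ] H)) (x : PiLp 2 (fun _ : n => H)) (i : n) :
    toOperator M x i = ∑ j, M i j (x j) := by
  classical
  simp only [toOperator, _root_.sum_apply, ContinuousLinearMap.comp_apply,
    adjoint_coord_apply, coord_apply, WithLp.ofLp_sum, Finset.sum_apply]
  rw [Finset.sum_eq_single i]
  · simp
  · intro k _ hk
    exact Finset.sum_eq_zero fun j _ => PiLp.single_eq_of_ne' 2 hk _
  · simp

lemma inner_toOperator (M : CStarMatrix n n (H →L[ℂ] H)) (x y : PiLp 2 (fun _ : n => H)) :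
    ⟪x, toOperator M y⟫_ℂ = ∑ i, ∑ j, ⟪x i, M i j (y j)⟫_ℂ := by
  simp only [PiLp.inner_apply, toOperator_apply, inner_sum]

/-- Matrices of operators on `H` form the algebra of operators on the Hilbert direct sum. -/
noncomputable def operatorEquiv :
    CStarMatrix n n (H →L[ℂ] H) ≃⋆ₐ[ℂ]
      (PiLp 2 (fun _ : n => H) →L[ℂ] PiLp 2 (fun _ : n => H)) where
  toFun := toOperator
  invFun T := CStarMatrix.ofMatrix fun i j => coord i ∘L T ∘L adjoint (coord j)
  left_inv M := by
    classical
    ext i j h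
    change toOperator M (adjoint (coord j) h) i = M i j h
    rw [toOperator_apply, adjoint_coord_apply]
    rw [Finset.sum_eq_single j]
    · simp
    · intro k _ hk
      rw [PiLp.single_eq_of_ne 2 hk, map_zero]
    · simp
  right_inv T := by
    classical
    ext x i
    rw [toOperator_apply]
    change ∑ j, T (adjoint (coord j) (x j)) i = T x i
    simp only [adjoint_coord_apply]
    have hx : x = ∑ j, PiLp.single 2 j (x j) := by
      ext k
      rw [WithLp.ofLp_sum, Finset.sum_apply, Finset.sum_eq_single k]
      · simp
      · intro j _ hj
        exact PiLp.single_eq_of_ne' 2 hj _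
      · simp
    conv_rhs => rw [hx, map_sum, WithLp.ofLp_sum, Finset.sum_apply]
  map_mul' M N := by
    ext x i
    simp only [_root_.mul_apply_eq_comp, toOperator_apply, CStarMatrix.mul_apply,
      _root_.sum_apply, map_sum]
    exact Finset.sum_comm
  map_add' M N := by
    ext x i
    simp [toOperator_apply, Finset.sum_add_distrib]
  map_smul' c M := by
    ext x i
    simp [toOperator_apply, Finset.smul_sum]
  map_star' M := by
    rw [star_eq_adjoint]
    refine (eq_adjoint_iff _ _).2 fun x y => ?_
    rw [← inner_conj_symm, inner_toOperator, inner_toOperator, map_sum, Finset.sum_comm]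
    simp [CStarMatrix.star_apply, star_eq_adjoint, adjoint_inner_right]

/-- Star isomorphisms preserve positivity, so the abstract order becomes a condition on scalar
quadratic forms, which passes to weak limits. -/
lemma nonneg_iff (M : CStarMatrix n n (H →L[ℂ] H)) :
    0 ≤ M ↔ ∀ x : n → H, 0 ≤ ∑ i, ∑ j, ⟪x i, M i j (x j)⟫_ℂ := by
  have key : 0 ≤ M ↔ 0 ≤ toOperator M := by
    refine ⟨fun h => map_nonneg (operatorEquiv (H := H) (n := n)) h, fun h => ?_⟩
    have := map_nonneg (operatorEquiv (H := H) (n := n)).symm h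
    rwa [show toOperator M = (operatorEquiv (H := H) (n := n)) M from rfl,
      StarAlgEquiv.symm_apply_apply] at this
  rw [key, nonneg_iff_isPositive]
  constructor
  · intro h x
    have := h.inner_nonneg_right (WithLp.toLp 2 x)
    rwa [inner_toOperator] at this
  · intro h
    refine (isPositive_iff_complex _).2 fun x => ?_
    have hx := h x
    rw [← inner_toOperator, Complex.nonneg_iff] at hx
    have hc : ⟪toOperator M x, x⟫_ℂ = starRingEnd ℂ ⟪x, toOperator M x⟫_ℂ :=
      (inner_conj_symm _ _).symm
    rw [hc]
    refine ⟨Complex.ext ?_ ?_, ?_⟩ <;>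
      simp only [RCLike.re_to_complex, Complex.ofReal_re, Complex.ofReal_im, Complex.conj_re,
        Complex.conj_im, ← hx.2, neg_zero, hx.1]

end Equiv

/-! ### Weak operator limits -/

section Limits

variable {H : Type*} [NormedAddCommGroup H] [InnerProductSpace ℂ H]

/-- A uniformly bounded family of operators converges weakly along every ultrafilter. -/
lemma exists_weak_ultralimit [CompleteSpace H] {ι : Type*} (U : Ultrafilter ι) (F : ι → H →L[ℂ] H) (C : ℝ)
    (hF : ∀ i, ‖F i‖ ≤ C) :
    ∃ T : H →L[ℂ] H, ∀ x y, Tendsto (fun i => ⟪x, F i y⟫_ℂ) U (𝓝 ⟪x, T y⟫_ℂ) := by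
  have hC : ∀ x y i, ‖⟪F i x, y⟫_ℂ‖ ≤ C * ‖x‖ * ‖y‖ := fun x y i =>
    (norm_inner_le_norm _ _).trans
      (mul_le_mul_of_nonneg_right ((F i).le_of_opNorm_le (hF i) x) (norm_nonneg _))
  -- Each matrix coefficient stays in a compact disc; its limits form a bounded sesquilinear form,
  -- which an operator represents.
  have hlim : ∀ x y, ∃ z : ℂ, ‖z‖ ≤ C * ‖x‖ * ‖y‖ ∧ Tendsto (fun i => ⟪F i x, y⟫_ℂ) U (𝓝 z) := by
    intro x y
    obtain ⟨z, hz, hz'⟩ := (isCompact_closedBall (0 : ℂ) (C * ‖x‖ * ‖y‖)).ultrafilter_le_nhds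
      (U.map fun i => ⟪F i x, y⟫_ℂ)
      (le_principal_iff.2 (Filter.mem_map.2 (Filter.univ_mem' fun i => by simpa using hC x y i)))
    exact ⟨z, by simpa using hz, hz'⟩
  choose B hB hBt using hlim
  let L : H →L⋆[ℂ] H →L[ℂ] ℂ := LinearMap.mkContinuous₂
    (LinearMap.mk₂'ₛₗ (starRingEnd ℂ) (RingHom.id ℂ) B
      (fun x x' y => tendsto_nhds_unique (hBt _ _) (by
        simpa [inner_add_left] using (hBt x y).add (hBt x' y)))
      (fun c x y => tendsto_nhds_unique (hBt _ _) (by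
        simpa [inner_smul_left, mul_comm] using (hBt x y).const_mul (starRingEnd ℂ c)))
      (fun x y y' => tendsto_nhds_unique (hBt _ _) (by
        simpa [inner_add_right] using (hBt x y).add (hBt x y')))
      (fun c x y => tendsto_nhds_unique (hBt _ _) (by
        simpa [inner_smul_right] using (hBt x y).const_mul c)))
    C hB
  refine ⟨InnerProductSpace.continuousLinearMapOfBilin L, fun x y => ?_⟩
  have hT : ⟪x, InnerProductSpace.continuousLinearMapOfBilin L y⟫_ℂ = starRingEnd ℂ (B y x) := by
    rw [← inner_conj_symm, InnerProductSpace.continuousLinearMapOfBilin_apply]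
    rfl
  rw [hT]
  have := (Complex.continuous_conj.tendsto (B y x)).comp (hBt y x)
  refine this.congr fun i => ?_
  simp

/-- Testing against `T y` itself gives `‖T y‖² ≤ ‖T y‖ C ‖y‖`. -/
lemma norm_le_of_weak_limit {ι : Type*} {l : Filter ι} [l.NeBot] {F : ι → H →L[ℂ] H} {T : H →L[ℂ] H}
    (hT : ∀ x y, Tendsto (fun i => ⟪x, F i y⟫_ℂ) l (𝓝 ⟪x, T y⟫_ℂ)) {C : ℝ} (hC : 0 ≤ C)
    (hF : ∀ᶠ i in l, ‖F i‖ ≤ C) : ‖T‖ ≤ C := by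
  refine T.opNorm_le_bound hC fun y => ?_
  have h : ‖⟪T y, T y⟫_ℂ‖ ≤ ‖T y‖ * (C * ‖y‖) := by
    refine le_of_tendsto (hT (T y) y).norm (hF.mono fun i hi => ?_)
    exact (norm_inner_le_norm _ _).trans
      (mul_le_mul_of_nonneg_left ((F i).le_of_opNorm_le hi y) (norm_nonneg _))
  rw [inner_self_eq_norm_sq_to_K] at h
  rcases (norm_nonneg (T y)).eq_or_lt with h0 | h0
  · rw [← h0]; positivity
  · refine le_of_mul_le_mul_left ?_ h0
    simpa [sq] using h

lemma eq_of_weak_limit {ι : Type*} {l : Filter ι} [l.NeBot] {F G : ι → H →L[ℂ] H}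
    {S T : H →L[ℂ] H} (hS : ∀ x y, Tendsto (fun i => ⟪x, F i y⟫_ℂ) l (𝓝 ⟪x, S y⟫_ℂ))
    (hT : ∀ x y, Tendsto (fun i => ⟪x, G i y⟫_ℂ) l (𝓝 ⟪x, T y⟫_ℂ)) (h : ∀ i, F i = G i) :
    S = T := by
  obtain rfl : F = G := funext h
  ext y
  exact ext_inner_left ℂ fun x => tendsto_nhds_unique (hS x y) (hT x y)

end Limits

end OperatorMatrix

/-! ### Completely positive maps: operations, contractivity, limits -/

namespace CompletelyPositiveMap

open ContinuousLinearMap Filter OperatorMatrix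
open scoped InnerProductSpace ComplexOrder Topology

section General

variable {A₁ A₂ A₃ : Type*} [NonUnitalCStarAlgebra A₁] [NonUnitalCStarAlgebra A₂]
  [NonUnitalCStarAlgebra A₃] [PartialOrder A₁] [PartialOrder A₂] [PartialOrder A₃]
  [StarOrderedRing A₁] [StarOrderedRing A₂] [StarOrderedRing A₃]

/-- The composition of completely positive maps. -/
noncomputable def comp (ψ : A₂ →CP A₃) (φ : A₁ →CP A₂) : A₁ →CP A₃ where
  toLinearMap := ψ.toLinearMap ∘ₗ φ.toLinearMap
  map_cstarMatrix_nonneg' k M hM :=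
    ψ.map_cstarMatrix_nonneg' k _ (φ.map_cstarMatrix_nonneg' k M hM)

@[simp]
lemma comp_apply (ψ : A₂ →CP A₃) (φ : A₁ →CP A₂) (x : A₁) : comp ψ φ x = ψ (φ x) := rfl

/-- The identity as a completely positive map. -/
noncomputable def identity : A₁ →CP A₁ where
  toLinearMap := LinearMap.id
  map_cstarMatrix_nonneg' _ _ hM := hM

@[simp]
lemma identity_apply (x : A₁) : (identity : A₁ →CP A₁) x = x := rfl

/-- The sum of completely positive maps. -/
noncomputable def add (φ ψ : A₁ →CP A₂) : A₁ →CP A₂ where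
  toLinearMap := φ.toLinearMap + ψ.toLinearMap
  map_cstarMatrix_nonneg' k M hM :=
    add_nonneg (φ.map_cstarMatrix_nonneg' k M hM) (ψ.map_cstarMatrix_nonneg' k M hM)

@[simp]
lemma add_apply (φ ψ : A₁ →CP A₂) (x : A₁) : add φ ψ x = φ x + ψ x := rfl

end General

/-- The quadratic form of the operator matrix with diagonal `c` and off-diagonal `x`, `star x`. -/
lemma two_by_two_form {H : Type*} [NormedAddCommGroup H] [InnerProductSpace ℂ H] (c : ℂ) (x y : H →L[ℂ] H) (v : Fin 2 → H) :
    ∑ i, ∑ j, ⟪v i, (!![c • 1, x; y, c • 1] : Matrix (Fin 2) (Fin 2) (H →L[ℂ] H)) i j (v j)⟫_ℂ =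
      c * (‖v 0‖ ^ 2 + ‖v 1‖ ^ 2 : ℝ) + ⟪v 0, x (v 1)⟫_ℂ + ⟪v 1, y (v 0)⟫_ℂ := by
  simp only [Fin.sum_univ_two, Matrix.of_apply, Matrix.cons_val', Matrix.cons_val_zero,
    Matrix.cons_val_one, Matrix.cons_val_fin_one, _root_.smul_apply,
    _root_.one_apply_eq_self, inner_smul_right, inner_self_eq_norm_sq_to_K]
  push_cast
  simp only [Complex.coe_algebraMap]
  ring

section Operators

variable {H : Type*} [NormedAddCommGroup H] [InnerProductSpace ℂ H] [CompleteSpace H]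

/-- A nonnegative multiple of a completely positive map. -/
noncomputable def smulNonneg (c : ℝ) (hc : 0 ≤ c) (φ : (H →L[ℂ] H) →CP (H →L[ℂ] H)) :
    (H →L[ℂ] H) →CP (H →L[ℂ] H) where
  toLinearMap := (c : ℂ) • φ.toLinearMap
  map_cstarMatrix_nonneg' k M hM := by
    refine (nonneg_iff _).2 fun v => ?_
    have h := mul_nonneg (Complex.zero_le_real.2 hc)
      ((nonneg_iff _).1 (φ.map_cstarMatrix_nonneg' k M hM) v)
    simp only [Finset.mul_sum, ← inner_smul_right] at h
    exact h

@[simp]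
lemma smulNonneg_apply (c : ℝ) (hc : 0 ≤ c) (φ : (H →L[ℂ] H) →CP (H →L[ℂ] H)) (x : H →L[ℂ] H) :
    smulNonneg c hc φ x = (c : ℂ) • φ x := rfl

/-- A unital completely positive map between operator algebras is contractive. -/
lemma norm_apply_le (φ : (H →L[ℂ] H) →CP (H →L[ℂ] H)) (h1 : φ 1 = 1) (x : H →L[ℂ] H) :
    ‖φ x‖ ≤ ‖x‖ := by
  rcases (norm_nonneg x).eq_or_lt with h0 | h0
  · rw [norm_eq_zero.1 h0.symm, map_zero]
  -- This matrix is positive because its off-diagonal entry has norm at most `‖x‖`; unitality keeps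
  -- the diagonal under `φ`.
  let M : CStarMatrix (Fin 2) (Fin 2) (H →L[ℂ] H) :=
    CStarMatrix.ofMatrix !![(‖x‖ : ℂ) • 1, x; star x, (‖x‖ : ℂ) • 1]
  have hM : 0 ≤ M := by
    refine (nonneg_iff M).2 fun v => ?_
    refine (two_by_two_form (‖x‖ : ℂ) x (star x) v).symm ▸ ?_
    rw [star_eq_adjoint, adjoint_inner_right, ← inner_conj_symm (x (v 1)) (v 0), add_assoc,
      Complex.add_conj, ← Complex.ofReal_mul, ← Complex.ofReal_add]
    refine Complex.zero_le_real.2 ?_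
    have h2 : |(⟪v 0, x (v 1)⟫_ℂ).re| ≤ ‖v 0‖ * (‖x‖ * ‖v 1‖) :=
      (Complex.abs_re_le_norm _).trans ((norm_inner_le_norm _ _).trans
        (mul_le_mul_of_nonneg_left (x.le_opNorm _) (norm_nonneg _)))
    have h3 := (abs_le.1 h2).1
    nlinarith [mul_nonneg h0.le (sq_nonneg (‖v 0‖ - ‖v 1‖))]
  have hφ : 0 ≤ M.map φ := φ.map_cstarMatrix_nonneg M hM
  have hMφ : M.map φ = CStarMatrix.ofMatrix
      !![(‖x‖ : ℂ) • 1, φ x; φ (star x), (‖x‖ : ℂ) • 1] := by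
    refine CStarMatrix.ext fun i j => ?_
    have hc : φ ((‖x‖ : ℂ) • 1) = (‖x‖ : ℂ) • 1 := by rw [map_smul, h1]
    fin_cases i <;> fin_cases j
    exacts [hc, rfl, rfl, hc]
  rw [hMφ, nonneg_iff] at hφ
  have hform : ∀ v : Fin 2 → H, 0 ≤ (‖x‖ : ℂ) * (‖v 0‖ ^ 2 + ‖v 1‖ ^ 2 : ℝ) +
      ⟪v 0, φ x (v 1)⟫_ℂ + ⟪v 1, φ (star x) (v 0)⟫_ℂ := fun v =>
    two_by_two_form (‖x‖ : ℂ) (φ x) (φ (star x)) v ▸ hφ v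
  clear hφ hMφ hM
  -- The form is real at `η` and at `iη`, which yields `φ(x*) = φ(x)*`.
  have hsym : ∀ ξ η, ⟪η, φ (star x) ξ⟫_ℂ = starRingEnd ℂ ⟪ξ, φ x η⟫_ℂ := by
    intro ξ η
    have e1 := (Complex.nonneg_iff.1 (hform ![ξ, η])).2
    have e2 := (Complex.nonneg_iff.1 (hform ![ξ, Complex.I • η])).2
    simp only [Matrix.cons_val_zero, Matrix.cons_val_one, Matrix.cons_val_fin_one, map_smul,
      inner_smul_left, inner_smul_right, Complex.add_im, Complex.mul_im, Complex.ofReal_im,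
      Complex.ofReal_re, Complex.conj_I, Complex.I_re, Complex.I_im, Complex.neg_re,
      Complex.neg_im] at e1 e2
    refine Complex.ext ?_ ?_ <;> simp only [Complex.conj_re, Complex.conj_im] <;> linarith
  refine (φ x).opNorm_le_bound (norm_nonneg _) fun ξ => ?_
  -- At this vector the form equals `‖x‖ (‖x‖² ‖ξ‖² - ‖φ x ξ‖²)`.
  have h := (Complex.nonneg_iff.1 (hform ![-(φ x ξ), (‖x‖ : ℂ) • ξ])).1
  rw [hsym] at h
  simp only [Matrix.cons_val_zero, Matrix.cons_val_one, Matrix.cons_val_fin_one, map_smul,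
    inner_smul_right, inner_neg_left, norm_neg, norm_smul, inner_self_eq_norm_sq_to_K,
    Complex.add_re, Complex.conj_re] at h
  norm_num [← Complex.ofReal_pow, ← Complex.ofReal_mul] at h
  have hsq : ‖φ x ξ‖ ^ 2 ≤ (‖x‖ * ‖ξ‖) ^ 2 := by
    refine le_of_mul_le_mul_left ?_ h0
    nlinarith
  exact le_of_sq_le_sq hsq (by positivity)

/-- Weak point-ultralimits of uniformly bounded completely positive maps exist. -/
lemma exists_ultralimit {ι : Type*} (U : Ultrafilter ι) (Φ : ι → (H →L[ℂ] H) →CP (H →L[ℂ] H))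
    (hΦ : ∀ i x, ‖Φ i x‖ ≤ ‖x‖) :
    ∃ φ : (H →L[ℂ] H) →CP (H →L[ℂ] H), ∀ (a : H →L[ℂ] H) (x y : H),
      Tendsto (fun i => ⟪x, Φ i a y⟫_ℂ) U (𝓝 ⟪x, φ a y⟫_ℂ) := by
  choose T hT using fun a => exists_weak_ultralimit U (fun i => Φ i a) ‖a‖ fun i => hΦ i a
  refine ⟨{ toFun := T
            map_add' := fun a b => eq_of_weak_limit (hT (a + b))
              (G := fun i => Φ i a + Φ i b) (fun x y => ?_) fun i => map_add _ _ _
            map_smul' := fun c a => eq_of_weak_limit (hT (c • a))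
              (G := fun i => c • Φ i a) (fun x y => ?_) fun i => map_smul _ _ _
            map_cstarMatrix_nonneg' := fun k M hM => ?_ }, hT⟩
  · simpa [inner_add_right] using (hT a x y).add (hT b x y)
  · simpa [inner_smul_right] using (hT a x y).const_mul c
  · refine (nonneg_iff _).2 fun v => ?_
    have hlim : Tendsto (fun m => ∑ i, ∑ j, ⟪v i, Φ m (M i j) (v j)⟫_ℂ) U
        (𝓝 (∑ i, ∑ j, ⟪v i, T (M i j) (v j)⟫_ℂ)) :=
      tendsto_finsetSum _ fun i _ => tendsto_finsetSum _ fun j _ => hT (M i j) (v i) (v j)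
    exact ge_of_tendsto' hlim fun m =>
      (nonneg_iff _).1 ((Φ m).map_cstarMatrix_nonneg M hM) v

end Operators

end CompletelyPositiveMap

/-! ### Minimal `G`-maps -/

namespace CovariantRep

open Filter CompletelyPositiveMap OperatorMatrix
open scoped InnerProductSpace Topology

variable {G A H : Type*} [Group G] [NonUnitalCStarAlgebra A] {α : G →* (A ≃⋆ₐ[ℂ] A)}
  [NormedAddCommGroup H] [InnerProductSpace ℂ H] [CompleteSpace H] (R : CovariantRep α H)

lemma identity_mem_gMapsFixing : (identity : (H →L[ℂ] H) →CP (H →L[ℂ] H)) ∈ R.gMapsFixing :=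
  ⟨⟨rfl, fun _ _ => rfl⟩, fun _ _ => rfl⟩

variable {R}

lemma comp_mem_gMapsFixing {φ ψ : (H →L[ℂ] H) →CP (H →L[ℂ] H)} (hφ : φ ∈ R.gMapsFixing)
    (hψ : ψ ∈ R.gMapsFixing) : comp ψ φ ∈ R.gMapsFixing := by
  refine ⟨⟨?_, fun t x => ?_⟩, fun x hx => ?_⟩
  · rw [comp_apply, hφ.1.map_one, hψ.1.map_one]
  · rw [comp_apply, comp_apply, hφ.1.equivariant, hψ.1.equivariant]
  · rw [comp_apply, hφ.2 x hx, hψ.2 x hx]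

lemma norm_apply_le_of_mem {φ : (H →L[ℂ] H) →CP (H →L[ℂ] H)} (hφ : φ ∈ R.gMapsFixing)
    (x : H →L[ℂ] H) : ‖φ x‖ ≤ ‖x‖ :=
  φ.norm_apply_le hφ.1.map_one x

/-- The set of `G`-maps fixing `π(A^α)` is closed under point-weak limits. -/
lemma mem_gMapsFixing_of_weak_limit {ι : Type*} {l : Filter ι} [l.NeBot]
    {Φ : ι → (H →L[ℂ] H) →CP (H →L[ℂ] H)} (hΦ : ∀ i, Φ i ∈ R.gMapsFixing)
    {φ : (H →L[ℂ] H) →CP (H →L[ℂ] H)}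
    (h : ∀ (a : H →L[ℂ] H) (x y : H), Tendsto (fun i => ⟪x, Φ i a y⟫_ℂ) l (𝓝 ⟪x, φ a y⟫_ℂ)) :
    φ ∈ R.gMapsFixing := by
  refine ⟨⟨?_, fun t a => ?_⟩, fun a ha => ?_⟩
  · exact eq_of_weak_limit (h 1) (G := fun _ => 1) (fun _ _ => tendsto_const_nhds)
      fun i => (hΦ i).1.map_one
  · refine eq_of_weak_limit (h _) (fun x y => ?_) fun i => (hΦ i).1.equivariant t a
    simpa only [mul_apply_eq_comp, ← ContinuousLinearMap.adjoint_inner_left]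
      using h a (ContinuousLinearMap.adjoint (R.u t : H →L[ℂ] H) x)
        ((star (R.u t : H →L[ℂ] H)) y)
  · exact eq_of_weak_limit (h a) (G := fun _ => a) (fun _ _ => tendsto_const_nhds)
      fun i => (hΦ i).2 a ha

/-- Along a chain for a preorder there is an ultrafilter that is eventually above each element. -/
lemma exists_ultrafilter_of_isChain {X : Type*} {r : X → X → Prop} (hrefl : ∀ a, r a a)
    (htrans : ∀ {a b c}, r a b → r b c → r a c) {c : Set X} (hc : IsChain r c) (hne : c.Nonempty) :
    ∃ U : Ultrafilter c, ∀ a ∈ c, ∀ᶠ b : c in U, r a b.1 := by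
  have : Nonempty c := hne.to_subtype
  have : Std.Refl r := ⟨hrefl⟩
  have hdir : Directed (· ≥ ·) fun a : c => 𝓟 {b : c | r a.1 b.1} := by
    intro a b
    rcases hc.total a.2 b.2 with hab | hab
    · exact ⟨b, principal_mono.2 fun d hd => htrans hab hd, le_rfl⟩
    · exact ⟨a, le_rfl, principal_mono.2 fun d hd => htrans hab hd⟩
  have : (⨅ a : c, 𝓟 {b : c | r a.1 b.1}).NeBot := iInf_neBot_of_directed' hdir fun a =>
    principal_neBot_iff.2 ⟨a, hrefl a.1⟩
  exact ⟨Ultrafilter.of (⨅ a : c, 𝓟 {b : c | r a.1 b.1}), fun a ha =>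
    Ultrafilter.of_le _ (mem_iInf_of_mem ⟨a, ha⟩ (mem_principal_self _))⟩

/-- Along every ultrafilter, a family of `G`-maps fixing `π(A^α)` has a limit of the same kind
whose norm is bounded by every eventual bound. -/
lemma exists_mem_gMapsFixing_ultralimit {ι : Type*} (U : Ultrafilter ι)
    (Φ : ι → (H →L[ℂ] H) →CP (H →L[ℂ] H)) (hΦ : ∀ i, Φ i ∈ R.gMapsFixing) :
    ∃ φ ∈ R.gMapsFixing, ∀ (a : H →L[ℂ] H) (C : ℝ), 0 ≤ C → (∀ᶠ i in U, ‖Φ i a‖ ≤ C) →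
      ‖φ a‖ ≤ C := by
  obtain ⟨φ, hφ⟩ := exists_ultralimit U Φ fun i => norm_apply_le_of_mem (hΦ i)
  exact ⟨φ, mem_gMapsFixing_of_weak_limit hΦ hφ, fun a C hC h => norm_le_of_weak_limit (hφ a) hC h⟩

variable (R) in
lemma exists_isMinimalGMap : ∃ φ, R.IsMinimalGMap φ := by
  obtain ⟨m, hm⟩ : ∃ m : R.gMapsFixing, ∀ a : R.gMapsFixing,
      (∀ x, ‖a.1 x‖ ≤ ‖m.1 x‖) → ∀ x, ‖m.1 x‖ ≤ ‖a.1 x‖ := by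
    refine exists_maximal_of_chains_bounded
      -- The order is reversed, so maximal for `r` means minimal in `𝔐`.
      (r := fun φ ψ : R.gMapsFixing => ∀ x, ‖ψ.1 x‖ ≤ ‖φ.1 x‖) (fun c hc => ?_)
      fun h h' x => (h' x).trans (h x)
    rcases c.eq_empty_or_nonempty with rfl | hne
    · exact ⟨⟨identity, R.identity_mem_gMapsFixing⟩, fun a ha => absurd ha (Set.notMem_empty a)⟩
    obtain ⟨U, hU⟩ := exists_ultrafilter_of_isChain (fun _ _ => le_rfl)
      (fun h h' x => (h' x).trans (h x)) hc hne
    obtain ⟨φ, hφ, hφle⟩ := exists_mem_gMapsFixing_ultralimit U (fun a : c => a.1.1)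
      fun a => a.1.2
    exact ⟨⟨φ, hφ⟩, fun a ha x => hφle x _ (norm_nonneg _) ((hU a ha).mono fun b hb => hb x)⟩
  exact ⟨m.1, m.2, fun ψ hψ h => hm ⟨ψ, hψ⟩ h⟩

/-- Partial sums `φ + φ² + ⋯ + φⁿ⁺¹` of the iterates of a `G`-map. -/
noncomputable def iterateSum (φ : (H →L[ℂ] H) →CP (H →L[ℂ] H)) :
    ℕ → (H →L[ℂ] H) →CP (H →L[ℂ] H)
  | 0 => φ
  | n + 1 => add φ (comp (iterateSum φ n) φ)

lemma iterateSum_succ_apply (φ : (H →L[ℂ] H) →CP (H →L[ℂ] H)) (n : ℕ) (x : H →L[ℂ] H) :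
    iterateSum φ (n + 1) x = φ x + iterateSum φ n (φ x) := rfl

lemma iterateSum_of_fixed {φ : (H →L[ℂ] H) →CP (H →L[ℂ] H)} {x : H →L[ℂ] H} (hx : φ x = x)
    (n : ℕ) : iterateSum φ n x = ((n : ℂ) + 1) • x := by
  induction n with
  | zero => simp [iterateSum, hx]
  | succ n ih => rw [iterateSum_succ_apply, hx, ih]; push_cast; module

/-- Starting the sum at `φ` rather than the identity bounds every term by `‖φ x‖`, which puts the
means below `φ`. -/
lemma norm_iterateSum_le {φ : (H →L[ℂ] H) →CP (H →L[ℂ] H)} (h : ∀ x, ‖φ x‖ ≤ ‖x‖) (n : ℕ)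
    (x : H →L[ℂ] H) : ‖iterateSum φ n x‖ ≤ (n + 1) * ‖φ x‖ := by
  induction n generalizing x with
  | zero => simp [iterateSum]
  | succ n ih =>
    rw [iterateSum_succ_apply]
    refine (norm_add_le _ _).trans ?_
    have h1 := (ih (φ x)).trans (mul_le_mul_of_nonneg_left (h (φ x)) (by positivity))
    push_cast
    linarith

lemma iterateSum_sub (φ : (H →L[ℂ] H) →CP (H →L[ℂ] H)) (n : ℕ) (x : H →L[ℂ] H) :
    iterateSum φ n (x - φ x) = φ x - φ^[n + 2] x := by
  induction n generalizing x with
  | zero => simp [iterateSum]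
  | succ n ih =>
    rw [iterateSum_succ_apply, map_sub, ih, Function.iterate_succ_apply φ (n + 2)]
    abel

/-- The Cesàro means of the iterates of a `G`-map. -/
noncomputable def cesaroMean (φ : (H →L[ℂ] H) →CP (H →L[ℂ] H)) (n : ℕ) :
    (H →L[ℂ] H) →CP (H →L[ℂ] H) :=
  smulNonneg ((n : ℝ) + 1)⁻¹ (by positivity) (iterateSum φ n)

lemma cesaroMean_apply (φ : (H →L[ℂ] H) →CP (H →L[ℂ] H)) (n : ℕ) (x : H →L[ℂ] H) :
    cesaroMean φ n x = (((n : ℝ) + 1)⁻¹ : ℝ) • iterateSum φ n x := by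
  rw [cesaroMean, smulNonneg_apply, Complex.coe_smul]

lemma cesaroMean_of_fixed {φ : (H →L[ℂ] H) →CP (H →L[ℂ] H)} {x : H →L[ℂ] H} (hx : φ x = x)
    (n : ℕ) : cesaroMean φ n x = x := by
  have hn : (n : ℂ) + 1 ≠ 0 := Nat.cast_add_one_ne_zero n
  rw [cesaroMean, smulNonneg_apply, iterateSum_of_fixed hx, smul_smul]
  push_cast
  rw [inv_mul_cancel₀ hn, one_smul]

lemma cesaroMean_mem_gMapsFixing {φ : (H →L[ℂ] H) →CP (H →L[ℂ] H)} (hφ : φ ∈ R.gMapsFixing)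
    (n : ℕ) : cesaroMean φ n ∈ R.gMapsFixing := by
  refine ⟨⟨cesaroMean_of_fixed hφ.1.map_one n, fun t x => ?_⟩,
    fun x hx => cesaroMean_of_fixed (hφ.2 x hx) n⟩
  have h : ∀ y, iterateSum φ n ((R.u t : H →L[ℂ] H) * y * star (R.u t : H →L[ℂ] H)) =
      (R.u t : H →L[ℂ] H) * iterateSum φ n y * star (R.u t : H →L[ℂ] H) := by
    intro y
    induction n generalizing y with
    | zero => exact hφ.1.equivariant t y
    | succ n ih =>
      rw [iterateSum_succ_apply, iterateSum_succ_apply, hφ.1.equivariant, ih, mul_add, add_mul]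
  rw [cesaroMean, smulNonneg_apply, smulNonneg_apply, h, mul_smul_comm, smul_mul_assoc]

/-- A minimal `G`-map is idempotent. -/
lemma IsMinimalGMap.idempotent {φ : (H →L[ℂ] H) →CP (H →L[ℂ] H)} (hφ : R.IsMinimalGMap φ)
    (x : H →L[ℂ] H) : φ (φ x) = φ x := by
  have hle := norm_apply_le_of_mem hφ.1
  have hmin : ∀ n y, ‖φ y‖ ≤ ‖cesaroMean φ n y‖ := fun n =>
    hφ.2 _ (cesaroMean_mem_gMapsFixing hφ.1 n) fun y => by
      rw [cesaroMean_apply, norm_smul, Real.norm_of_nonneg (by positivity),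
        inv_mul_le_iff₀ (by positivity)]
      exact norm_iterateSum_le hle n y
  have hiter : ∀ n : ℕ, ‖φ^[n] x‖ ≤ ‖x‖ := by
    intro n
    induction n with
    | zero => rfl
    | succ n ih => rw [Function.iterate_succ_apply']; exact (hle _).trans ih
  have hbound : ∀ n : ℕ, ‖φ (x - φ x)‖ ≤ 2 * ‖x‖ * (1 / ((n : ℝ) + 1)) := by
    intro n
    refine (hmin n _).trans ?_
    rw [cesaroMean_apply, iterateSum_sub, norm_smul, Real.norm_of_nonneg (by positivity),
      one_div, mul_comm]
    gcongr
    refine (norm_sub_le _ _).trans ?_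
    linarith [hle x, hiter (n + 2)]
  have hlim : Tendsto (fun n : ℕ => 2 * ‖x‖ * (1 / ((n : ℝ) + 1))) atTop (𝓝 0) := by
    simpa using tendsto_one_div_add_atTop_nhds_zero_nat.const_mul (2 * ‖x‖)
  have h0 := norm_le_zero_iff.1 (ge_of_tendsto' hlim hbound)
  rw [map_sub, sub_eq_zero] at h0
  exact h0.symm

/-- If `E` is a `G`-projection onto `π(A^α)`, every minimal `G`-map has image `π(A^α)`. -/
lemma IsMinimalGMap.range_eq_of_isGProjectionOnto {φ E : (H →L[ℂ] H) →CP (H →L[ℂ] H)}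
    (hφ : R.IsMinimalGMap φ) (hE : R.IsGProjectionOnto E (R.fixedImage : Set (H →L[ℂ] H))) :
    Set.range φ = (R.fixedImage : Set (H →L[ℂ] H)) := by
  have hEmem : ∀ x, E x ∈ R.fixedImage := fun x => by
    have : E x ∈ Set.range E := ⟨x, rfl⟩
    rwa [hE.range_eq] at this
  have hE' : E ∈ R.gMapsFixing := by
    refine ⟨hE.toIsGMap, fun x hx => ?_⟩
    have : x ∈ Set.range E := by rw [hE.range_eq]; exact hx
    obtain ⟨y, rfl⟩ := this
    exact hE.idempotent y
  have hmin := hφ.2 _ (comp_mem_gMapsFixing hφ.1 hE') fun x =>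
    norm_apply_le_of_mem hE' (φ x)
  refine Set.Subset.antisymm ?_ fun x hx => ⟨x, hφ.1.2 x hx⟩
  rintro _ ⟨x, rfl⟩
  -- This difference is fixed by `φ` and killed by `E`, so `E ∘ φ` annihilates it; minimality makes
  -- it vanish.
  have hfix : φ (φ x - E (φ x)) = φ x - E (φ x) := by
    rw [map_sub, hφ.idempotent, hφ.1.2 _ (hEmem _)]
  have h := hmin (φ x - E (φ x))
  rw [comp_apply, hfix, map_sub, hE.idempotent, sub_self, norm_zero, norm_le_zero_iff,
    sub_eq_zero] at h
  rw [h]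
  exact hEmem _

end CovariantRep

/-- The boundary exists, and (in whichever realization as the image of a minimal element of `𝔐`)
it equals `π(A^α)` if and only if the covariant representation is amenable. -/
theorem proposition3p5 {G A H : Type*} [Group G] [NonUnitalCStarAlgebra A]
    (α : G →* (A ≃⋆ₐ[ℂ] A)) [NormedAddCommGroup H] [InnerProductSpace ℂ H] [CompleteSpace H]
    (R : CovariantRep α H) :
    (∃ B : Set (H →L[ℂ] H), R.IsBoundary B) ∧
      ∀ B : Set (H →L[ℂ] H), R.IsBoundary B →
        (B = (R.fixedImage : Set (H →L[ℂ] H)) ↔ R.IsAmenable) := by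
  refine ⟨?_, ?_⟩
  · obtain ⟨φ, hφ⟩ := R.exists_isMinimalGMap
    exact ⟨_, φ, hφ, rfl⟩
  · rintro _ ⟨φ, hφ, rfl⟩
    constructor
    · intro h
      exact ⟨φ, { toIsGMap := hφ.1.1, idempotent := hφ.idempotent, range_eq := h }⟩
    · rintro ⟨E, hE⟩
      exact hφ.range_eq_of_isGProjectionOnto hE
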